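/- Let $S$ be a monoid. For $s,t\in S$ write $s\sim_s^1 t$ if there are an integer $n\ge 1$, elements $p_1,\dots,p_n\in S$ and a permutation $f$ of $\{1,\dots,n\}$ such that $s=p_1\cdots p_n$ and $t=p_{f(1)}\cdots p_{f(n)}$, and let $\sim_s$ be the transitive closure of $\sim_s^1$; this is an equivalence relation on $S$. For a set $\Omega$ let $\mathcal{T}(\Omega)$ be the monoid of all functions $\Omega\to\Omega$, $\mathcal{PT}(\Omega)$ the monoid of all partial functions from $\Omega$ to $\Omega$, and $\mathcal{I}(\Omega)$ the monoid of all bijections between subsets of $\Omega$, each under composition. (1) If $\Omega$ is infinite, then $\sim_s$ is the universal relation on each of $\mathcal{T}(\Omega)$, $\mathcal{PT}(\Omega)$ and $\mathcal{I}(\Omega)$. (2) If $\Omega$ is finite and $S$ is any one of these three monoids, then the $\sim_s$-classes of $S$ are exactly the nonempty sets among the following three: the set of even permutations of $\Omega$, the set of odd permutations of $\Omega$, and the set of elements of $S$ whose image has fewer than $|\Omega|$ elements. If moreover $|\Omega|\ge 2$, then all three of these sets are $\sim_s$-classes, and $S$ has exactly three $\sim_s$-classes. -/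

import Mathlib

section PermutationConjugacy

variable {M : Type*} [Monoid M]

/-- One-step permutation conjugacy in a monoid: `s = p₁ ⋯ pₙ` and `t = p_{f(1)} ⋯ p_{f(n)}` for some
`n ≥ 1`, some elements `p₁, …, pₙ` and some permutation `f` of the indices. -/
def PermConjStep (s t : M) : Prop :=
  ∃ n : ℕ, 0 < n ∧ ∃ (p : Fin n → M) (f : Equiv.Perm (Fin n)),
    s = (List.ofFn p).prod ∧ (List.ofFn fun i => p (f i)).prod = t

/-- Permutation conjugacy: the transitive closure of the one-step relation. -/
def PermConj : M → M → Prop := Relation.TransGen PermConjStep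

theorem PermConjStep.refl (s : M) : PermConjStep s s :=
  ⟨1, Nat.one_pos, fun _ => s, 1, by simp, by simp⟩

theorem PermConjStep.symm {s t : M} (h : PermConjStep s t) : PermConjStep t s := by
  obtain ⟨n, hn, p, f, hs, ht⟩ := h
  exact ⟨n, hn, fun i => p (f i), f.symm, ht.symm, by simp [hs]⟩

theorem PermConj.symm {s t : M} (h : PermConj s t) : PermConj t s := by
  induction h with
  | single h => exact Relation.TransGen.single h.symm
  | tail _ h ih => exact Relation.TransGen.head h.symm ih

variable (M) in
/-- Permutation conjugacy, as an equivalence relation on the monoid `M`. -/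
def permConjSetoid : Setoid M where
  r := PermConj
  iseqv :=
    { refl := fun s => Relation.TransGen.single (PermConjStep.refl s)
      symm := PermConj.symm
      trans := fun h₁ h₂ => Relation.TransGen.trans h₁ h₂ }

end PermutationConjugacy

section TransformationMonoids

variable (Ω : Type*)

/-- The full transformation monoid, with product `s * t = s ∘ t`. -/
abbrev FullTransf : Type _ := Function.End Ω

/-- The type underlying the partial transformation monoid: all partial functions from `Ω` to `Ω`. -/
abbrev PartialTransf : Type _ := Ω →. Ω

/-- The type underlying the symmetric inverse monoid: all bijections between subsets of `Ω`. -/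
abbrev SymmInv : Type _ := Ω ≃. Ω

/-- The product of partial functions is their composition: `s * t` is `t` followed by `s`. -/
instance PartialTransf.instMonoid : Monoid (PartialTransf Ω) where
  mul s t := PFun.comp s t
  one := PFun.id Ω
  mul_assoc s t u := PFun.comp_assoc s t u
  one_mul s := PFun.id_comp s
  mul_one s := PFun.comp_id s

/-- The product of partial bijections is their composition: `s * t` is `t` followed by `s`. -/
instance SymmInv.instMonoid : Monoid (SymmInv Ω) where
  mul s t := PEquiv.trans t s
  one := PEquiv.refl Ω
  mul_assoc s t u := (PEquiv.trans_assoc u t s).symm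
  one_mul s := PEquiv.trans_refl s
  mul_one s := PEquiv.refl_trans s

variable {Ω}

/-- A permutation, as an element of the full transformation monoid. -/
def FullTransf.ofPerm (σ : Equiv.Perm Ω) : FullTransf Ω := fun x => σ x

/-- A permutation, as an element of the partial transformation monoid. -/
def PartialTransf.ofPerm (σ : Equiv.Perm Ω) : PartialTransf Ω := fun x => Part.some (σ x)

/-- A permutation, as an element of the symmetric inverse monoid. -/
def SymmInv.ofPerm (σ : Equiv.Perm Ω) : SymmInv Ω := Equiv.toPEquiv σ

/-- The image of a transformation. -/
def FullTransf.image (s : FullTransf Ω) : Set Ω := {y | ∃ x, s x = y}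

/-- The image of a partial transformation. -/
def PartialTransf.image (s : PartialTransf Ω) : Set Ω := {y | ∃ x, y ∈ s x}

/-- The image of a partial bijection. -/
def SymmInv.image (s : SymmInv Ω) : Set Ω := {y | ∃ x, y ∈ s x}

end TransformationMonoids

section ParityClasses

variable {Ω M : Type*} [Fintype Ω]

/-- The elements of `M` that are even permutations of `Ω`, where `ι` regards permutations
as elements of `M`. -/
def evenPerms [DecidableEq Ω] (ι : Equiv.Perm Ω → M) : Set M :=
  {s | ∃ σ : Equiv.Perm Ω, Equiv.Perm.sign σ = 1 ∧ ι σ = s}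

/-- The elements of `M` that are odd permutations of `Ω`, where `ι` regards permutations
as elements of `M`. -/
def oddPerms [DecidableEq Ω] (ι : Equiv.Perm Ω → M) : Set M :=
  {s | ∃ σ : Equiv.Perm Ω, Equiv.Perm.sign σ = -1 ∧ ι σ = s}

/-- The elements of `M` whose image has fewer than `|Ω|` elements. -/
def smallImage (im : M → Set Ω) : Set M :=
  {s | (im s).ncard < Fintype.card Ω}

end ParityClasses

/-!
Permutation conjugacy on a monoid is the least congruence whose quotient is commutative, so
`PermConj s t` holds exactly when `s` and `t` agree under every homomorphism to a commutative
monoid (`permConj_iff_forall_hom`).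

Infinite `Ω`: a bijection `Ω ⊕ Ω ≃ Ω` yields `r₁ s₁ = 1 = r₂ s₂` with `r₁ s₂` empty or constant, hence
a left zero. In a commutative quotient `1 = r₁ s₁ r₂ s₂ = (r₁ s₂) (s₁ r₂)`, so everything is
identified with that left zero (`permConj_of_left_zero`).

Finite `Ω`, upper bound: all transpositions are conjugate and square to `1`, so a homomorphism from
the symmetric group to a commutative monoid only depends on the sign. An element `s` whose image
misses `y` satisfies `s = e s`, where `e` is the idempotent that deletes `y` (or, for total maps,
collapses `y` to another point). These idempotents are conjugate to one another, so they have a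
common idempotent image in a commutative quotient; their product over all points is the empty map
(or a constant map), which therefore has the same image as `e`. As that map is a left zero,
`s` is identified with it.

Finite `Ω`, lower bound: a partial transformation has a `0`-`1` matrix, and the determinant of this
matrix is a homomorphism to `ℤ` that sends a permutation to its sign and an element with small image
to `0`, because the matrix of the latter has a zero row. The other two monoids map to the
partial transformations.
-/

/-! ### Permutation conjugacy and commutative quotients -/

section CommutativeQuotient

variable {M : Type*} [Monoid M]

theorem PermConjStep.map_eq {Q : Type*} [CommMonoid Q] (f : M →* Q) {s t : M}
    (h : PermConjStep s t) : f s = f t := by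
  obtain ⟨n, -, p, σ, rfl, rfl⟩ := h
  simp only [map_list_prod, List.map_ofFn, List.prod_ofFn, Function.comp_apply]
  exact (Equiv.prod_comp σ fun i => f (p i)).symm

theorem PermConj.map_eq {Q : Type*} [CommMonoid Q] (f : M →* Q) {s t : M}
    (h : PermConj s t) : f s = f t := by
  induction h with
  | single h => exact h.map_eq f
  | tail _ h ih => exact ih.trans (h.map_eq f)

theorem PermConjStep.mul_left (a : M) {s t : M} (h : PermConjStep s t) :
    PermConjStep (a * s) (a * t) := by
  obtain ⟨n, -, p, σ, rfl, rfl⟩ := h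
  refine ⟨n + 1, n.succ_pos, Fin.cons a p, Equiv.Perm.decomposeFin.symm (0, σ), ?_, ?_⟩
  · simp [List.ofFn_succ]
  · simp [List.ofFn_succ]

theorem permConjStep_mul_comm (s t : M) : PermConjStep (s * t) (t * s) :=
  ⟨2, two_pos, ![s, t], Equiv.swap 0 1, by simp [List.ofFn_succ], by simp [List.ofFn_succ]⟩

theorem PermConj.mul_left (a : M) {s t : M} (h : PermConj s t) : PermConj (a * s) (a * t) := by
  induction h with
  | single h => exact Relation.TransGen.single (h.mul_left a)
  | tail _ h ih => exact ih.tail (h.mul_left a)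

theorem permConj_mul_comm (s t : M) : PermConj (s * t) (t * s) :=
  Relation.TransGen.single (permConjStep_mul_comm s t)

theorem PermConj.trans {s t u : M} (h : PermConj s t) (h' : PermConj t u) : PermConj s u :=
  Relation.TransGen.trans h h'

theorem PermConj.mul {s t s' t' : M} (h : PermConj s t) (h' : PermConj s' t') :
    PermConj (s * s') (t * t') :=
  (h'.mul_left s).trans <| (permConj_mul_comm s t').trans <|
    (h.mul_left t').trans (permConj_mul_comm t' t)

variable (M) in
/-- Permutation conjugacy as a congruence. -/
def permConjCon : Con M where
  toSetoid := permConjSetoid M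
  mul' := PermConj.mul

/-- The quotient by permutation conjugacy is commutative. -/
instance permConjCon.commMonoid : CommMonoid (permConjCon M).Quotient where
  mul_comm := by
    rintro ⟨s⟩ ⟨t⟩
    exact (permConjCon M).eq.2 (permConj_mul_comm s t)

/-- Permutation conjugacy is the kernel of the universal homomorphism to a commutative monoid. -/
theorem permConj_iff_forall_hom {M : Type u} [Monoid M] {s t : M} :
    PermConj s t ↔ ∀ (Q : Type u) [CommMonoid Q] (f : M →* Q), f s = f t :=
  ⟨fun h _ _ f => h.map_eq f, fun h =>
    (permConjCon M).eq.1 (h (permConjCon M).Quotient (permConjCon M).mk')⟩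

theorem permConj_of_left_zero {r₁ s₁ r₂ s₂ : M} (h₁ : r₁ * s₁ = 1) (h₂ : r₂ * s₂ = 1)
    (hz : ∀ x, r₁ * s₂ * x = r₁ * s₂) (s t : M) : PermConj s t := by
  rw [permConj_iff_forall_hom]
  intro Q _ f
  have key : ∀ x, f x = f (r₁ * s₂) := fun x => calc
    f x = f (r₁ * s₁) * f (r₂ * s₂) * f x := by simp [h₁, h₂]
    _ = f (r₁ * s₂ * (s₁ * r₂ * x)) := by
      simp only [map_mul]
      ac_rfl
    _ = f (r₁ * s₂) := by rw [hz]
  rw [key s, key t]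

/-- A homomorphism to a commutative monoid cannot separate conjugate elements. -/
theorem map_eq_of_conj {Q : Type*} [CommMonoid Q] (f : M →* Q) {u v a : M} (h : u * v = 1) :
    f (u * a * v) = f a := by
  have := congrArg f h
  simp only [map_mul, map_one] at this ⊢
  rw [mul_right_comm, this, one_mul]

/-- Transpositions are mutually conjugate involutions, so a homomorphism to a commutative monoid
takes one value on even permutations and one on odd permutations. -/
theorem map_perm_eq_of_sign_eq {Ω Q : Type*} [Fintype Ω] [DecidableEq Ω] [CommMonoid Q]
    (f : Equiv.Perm Ω →* Q) {σ τ : Equiv.Perm Ω}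
    (h : Equiv.Perm.sign σ = Equiv.Perm.sign τ) : f σ = f τ := by
  by_cases hΩ : ∃ a b : Ω, a ≠ b
  · obtain ⟨a, b, hab⟩ := hΩ
    have hsq : f (Equiv.swap a b) * f (Equiv.swap a b) = 1 := by
      rw [← map_mul, Equiv.swap_mul_self, map_one]
    have key : ∀ ρ : Equiv.Perm Ω, (Equiv.Perm.sign ρ = 1 ∧ f ρ = 1) ∨
        (Equiv.Perm.sign ρ = -1 ∧ f ρ = f (Equiv.swap a b)) := by
      intro ρ
      induction ρ using Equiv.Perm.swap_induction_on with
      | one => simp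
      | swap_mul ρ x y hxy ih =>
        obtain ⟨c, hc⟩ := isConj_iff.1 (Equiv.Perm.isConj_swap hab hxy)
        have hf : f (Equiv.swap x y) = f (Equiv.swap a b) := by
          rw [← hc, map_eq_of_conj f (mul_inv_cancel c)]
        rcases ih with ⟨h1, h2⟩ | ⟨h1, h2⟩
        · right
          simp [h1, h2, hf, Equiv.Perm.sign_swap hxy]
        · left
          simp [h1, h2, hf, Equiv.Perm.sign_swap hxy, hsq]
    have hne : (1 : ℤˣ) ≠ -1 := by decide
    rcases key σ with ⟨h1, h2⟩ | ⟨h1, h2⟩ <;> rcases key τ with ⟨h3, h4⟩ | ⟨h3, h4⟩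
    · rw [h2, h4]
    · exact absurd (h1.symm.trans (h.trans h3)) hne
    · exact absurd (h3.symm.trans (h.symm.trans h1)) hne
    · rw [h2, h4]
  · push Not at hΩ
    congr 1
    ext x
    exact hΩ _ _

end CommutativeQuotient

/-! ### Embeddings into the three monoids -/

section Embeddings

variable {Ω : Type*}

theorem PartialTransf.mem_mul {s t : PartialTransf Ω} {x y : Ω} :
    y ∈ (s * t) x ↔ ∃ z, z ∈ t x ∧ y ∈ s z :=
  Part.mem_bind_iff

theorem PartialTransf.mem_one {x y : Ω} : y ∈ (1 : PartialTransf Ω) x ↔ y = x :=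
  Part.mem_some_iff

theorem FullTransf.mul_apply (s t : FullTransf Ω) (x : Ω) : (s * t) x = s (t x) := rfl

theorem FullTransf.one_apply (x : Ω) : (1 : FullTransf Ω) x = x := rfl

theorem SymmInv.mem_mul {s t : SymmInv Ω} {x y : Ω} :
    y ∈ (s * t) x ↔ ∃ z, z ∈ t x ∧ y ∈ s z :=
  PEquiv.mem_trans t s x y

theorem SymmInv.mem_one {x y : Ω} : y ∈ (1 : SymmInv Ω) x ↔ y = x :=
  Option.mem_some_iff.trans eq_comm

theorem SymmInv.ext_mem {s t : SymmInv Ω} (h : ∀ x y, y ∈ s x ↔ y ∈ t x) : s = t :=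
  PEquiv.ext fun x => Option.ext fun y => h x y

theorem PartialTransf.ext_mem {s t : PartialTransf Ω} (h : ∀ x y, y ∈ s x ↔ y ∈ t x) : s = t :=
  funext fun x => Part.ext fun y => h x y

/-- A total function, regarded as a partial function. -/
def FullTransf.toPartial : FullTransf Ω →* PartialTransf Ω where
  toFun s := fun x => Part.some (s x)
  map_one' := rfl
  map_mul' s t := PartialTransf.ext_mem fun x y => by
    refine Iff.trans ?_ PartialTransf.mem_mul.symm
    simp [FullTransf.mul_apply]

/-- A partial bijection, regarded as a partial function. -/
def SymmInv.toPartial : SymmInv Ω →* PartialTransf Ω where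
  toFun s := fun x => Part.ofOption (s x)
  map_one' := PartialTransf.ext_mem fun x y => by
    rw [PartialTransf.mem_one, ← SymmInv.mem_one, Part.mem_ofOption]
  map_mul' s t := PartialTransf.ext_mem fun x y => by
    refine Iff.trans ?_ PartialTransf.mem_mul.symm
    simp only [Part.mem_ofOption, SymmInv.mem_mul]

theorem SymmInv.mem_toPartial {s : SymmInv Ω} {x y : Ω} : y ∈ SymmInv.toPartial s x ↔ y ∈ s x :=
  Part.mem_ofOption

/-- The inclusion of the symmetric group in the full transformation monoid. -/
def FullTransf.permHom : Equiv.Perm Ω →* FullTransf Ω where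
  toFun := FullTransf.ofPerm
  map_one' := rfl
  map_mul' _ _ := rfl

/-- The inclusion of the symmetric group in the symmetric inverse monoid. -/
def SymmInv.permHom : Equiv.Perm Ω →* SymmInv Ω where
  toFun := SymmInv.ofPerm
  map_one' := Equiv.toPEquiv_refl
  map_mul' σ τ := Equiv.toPEquiv_trans τ σ

/-- The inclusion of the symmetric group in the partial transformation monoid. -/
def PartialTransf.permHom : Equiv.Perm Ω →* PartialTransf Ω where
  toFun := PartialTransf.ofPerm
  map_one' := rfl
  map_mul' σ τ := map_mul FullTransf.toPartial (FullTransf.permHom σ) (FullTransf.permHom τ)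

/-- The constant map with value `c`. -/
def FullTransf.const (c : Ω) : FullTransf Ω := fun _ => c

theorem FullTransf.const_mul (c : Ω) (s : FullTransf Ω) :
    FullTransf.const c * s = FullTransf.const c := rfl

theorem SymmInv.mem_ofPerm {σ : Equiv.Perm Ω} {x y : Ω} :
    y ∈ SymmInv.ofPerm σ x ↔ y = σ x := by
  simp [SymmInv.ofPerm, Equiv.toPEquiv_apply, eq_comm]

theorem SymmInv.toPartial_ofPerm (σ : Equiv.Perm Ω) :
    SymmInv.toPartial (SymmInv.ofPerm σ) = PartialTransf.ofPerm σ :=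
  PartialTransf.ext_mem fun x y => by
    simp [SymmInv.mem_toPartial, SymmInv.ofPerm, PartialTransf.ofPerm, Equiv.toPEquiv_apply,
      eq_comm]

theorem SymmInv.bot_mul (s : SymmInv Ω) : (⊥ : SymmInv Ω) * s = ⊥ :=
  PEquiv.trans_bot s

theorem PartialTransf.toPartial_bot_mul (s : PartialTransf Ω) :
    SymmInv.toPartial ⊥ * s = SymmInv.toPartial ⊥ :=
  PartialTransf.ext_mem fun x y => by
    simp [PartialTransf.mem_mul, SymmInv.mem_toPartial]

end Embeddings

/-! ### Infinite sets -/

section Infinite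

variable {Ω : Type*}

theorem exists_equiv_sum_self (Ω : Type*) [Infinite Ω] : Nonempty (Ω ⊕ Ω ≃ Ω) :=
  Cardinal.eq.1 (by simp)

/-- An infinite set splits into two copies of itself; the partial bijections `s₁`, `s₂` are the
two inclusions and `r₁`, `r₂` their inverses. -/
theorem SymmInv.exists_disjoint_sections [Infinite Ω] : ∃ r₁ s₁ r₂ s₂ : SymmInv Ω,
    r₁ * s₁ = 1 ∧ r₂ * s₂ = 1 ∧ r₁ * s₂ = ⊥ := by
  obtain ⟨g⟩ := exists_equiv_sum_self Ω
  let s₁ : SymmInv Ω :=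
    { toFun := fun x => some (g (Sum.inl x))
      invFun := fun y => (g.symm y).getLeft?
      inv := fun x y => by
        simp only [Sum.getLeft?_eq_some_iff, Option.some_inj]
        rw [Equiv.symm_apply_eq, eq_comm] }
  let s₂ : SymmInv Ω :=
    { toFun := fun x => some (g (Sum.inr x))
      invFun := fun y => (g.symm y).getRight?
      inv := fun x y => by
        simp only [Sum.getRight?_eq_some_iff, Option.some_inj]
        rw [Equiv.symm_apply_eq, eq_comm] }
  have m₁ : ∀ x y, y ∈ s₁ x ↔ g (Sum.inl x) = y := fun x y => Option.mem_some_iff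
  have m₂ : ∀ x y, y ∈ s₂ x ↔ g (Sum.inr x) = y := fun x y => Option.mem_some_iff
  refine ⟨s₁.symm, s₁, s₂.symm, s₂, ?_, ?_, ?_⟩ <;> refine SymmInv.ext_mem fun x y => ?_
  · rw [SymmInv.mem_mul, SymmInv.mem_one]
    simp only [PEquiv.mem_iff_mem, m₁]
    simp [eq_comm]
  · rw [SymmInv.mem_mul, SymmInv.mem_one]
    simp only [PEquiv.mem_iff_mem, m₂]
    simp [eq_comm]
  · rw [SymmInv.mem_mul]
    simp only [PEquiv.mem_iff_mem, m₁, m₂]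
    simp

theorem SymmInv.permConj_of_infinite [Infinite Ω] (s t : SymmInv Ω) : PermConj s t := by
  obtain ⟨r₁, s₁, r₂, s₂, h₁, h₂, h⟩ := SymmInv.exists_disjoint_sections (Ω := Ω)
  exact permConj_of_left_zero h₁ h₂ (fun x => by rw [h, SymmInv.bot_mul]) s t

theorem PartialTransf.permConj_of_infinite [Infinite Ω] (s t : PartialTransf Ω) :
    PermConj s t := by
  obtain ⟨r₁, s₁, r₂, s₂, h₁, h₂, h⟩ := SymmInv.exists_disjoint_sections (Ω := Ω)
  refine permConj_of_left_zero (r₁ := SymmInv.toPartial r₁) (s₁ := SymmInv.toPartial s₁)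
    (r₂ := SymmInv.toPartial r₂) (s₂ := SymmInv.toPartial s₂) ?_ ?_ (fun x => ?_) s t
  · rw [← map_mul, h₁, map_one]
  · rw [← map_mul, h₂, map_one]
  · rw [← map_mul, h, PartialTransf.toPartial_bot_mul]

theorem FullTransf.permConj_of_infinite [Infinite Ω] (s t : FullTransf Ω) : PermConj s t := by
  obtain ⟨g⟩ := exists_equiv_sum_self Ω
  obtain ⟨a⟩ : Nonempty Ω := inferInstance
  -- the retractions send the other half of `Ω` to `a`, so that `r₁ * s₂` is constant
  let r₁ : FullTransf Ω := fun y => Sum.elim id (fun _ => a) (g.symm y)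
  let s₁ : FullTransf Ω := fun x => g (Sum.inl x)
  let r₂ : FullTransf Ω := fun y => Sum.elim (fun _ => a) id (g.symm y)
  let s₂ : FullTransf Ω := fun x => g (Sum.inr x)
  refine permConj_of_left_zero (r₁ := r₁) (s₁ := s₁) (r₂ := r₂) (s₂ := s₂) ?_ ?_
    (fun x => ?_) s t <;> funext y
  · rw [FullTransf.mul_apply, FullTransf.one_apply]
    simp [r₁, s₁]
  · rw [FullTransf.mul_apply, FullTransf.one_apply]
    simp [r₂, s₂]
  · simp only [FullTransf.mul_apply]
    simp [r₁, s₂]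

end Infinite

/-! ### The determinant of a partial transformation -/

section Determinant

variable {Ω : Type*}

open Classical in
/-- The `0`-`1` matrix of a partial transformation; its column `x` records the value at `x`. -/
noncomputable def PartialTransf.toMatrix (s : PartialTransf Ω) : Matrix Ω Ω ℤ :=
  fun y x => if y ∈ s x then 1 else 0

theorem PartialTransf.toMatrix_apply_of_iff {s : PartialTransf Ω} {x y : Ω} {P : Prop}
    [Decidable P] (h : y ∈ s x ↔ P) : s.toMatrix y x = if P then 1 else 0 :=
  open Classical in if_congr h rfl rfl

variable [Fintype Ω] [DecidableEq Ω]

open Classical in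
theorem PartialTransf.toMatrix_mul (s t : PartialTransf Ω) :
    (s * t).toMatrix = s.toMatrix * t.toMatrix := by
  ext y x
  rw [Matrix.mul_apply, PartialTransf.toMatrix_apply_of_iff PartialTransf.mem_mul]
  by_cases h : ∃ z, z ∈ t x
  · obtain ⟨z, hz⟩ := h
    have huniq : ∀ w, w ∈ t x ↔ w = z :=
      fun w => ⟨fun hw => Part.mem_unique hw hz, fun hw => hw ▸ hz⟩
    simp [PartialTransf.toMatrix, huniq]
  · push Not at h
    simp [PartialTransf.toMatrix, h]

/-- The determinant of the matrix of a partial transformation, as a homomorphism. -/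
noncomputable def PartialTransf.det : PartialTransf Ω →* ℤ where
  toFun s := s.toMatrix.det
  map_one' := by
    rw [← Matrix.det_one (n := Ω) (R := ℤ)]
    congr 1
    ext y x
    simp [PartialTransf.toMatrix, PartialTransf.mem_one, Matrix.one_apply]
  map_mul' s t := by rw [PartialTransf.toMatrix_mul, Matrix.det_mul]

theorem PartialTransf.det_ofPerm (σ : Equiv.Perm Ω) :
    PartialTransf.det (PartialTransf.ofPerm σ) = Equiv.Perm.sign σ := by
  refine Eq.trans ?_ (Matrix.det_permutation σ)
  rw [← Matrix.det_transpose]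
  change Matrix.det _ = Matrix.det _
  congr 1
  ext y x
  simp [PartialTransf.toMatrix, PartialTransf.ofPerm, PEquiv.toMatrix_apply, Equiv.toPEquiv_apply,
    eq_comm]

theorem PartialTransf.det_eq_zero {s : PartialTransf Ω} {y : Ω} (hy : y ∉ s.image) :
    PartialTransf.det s = 0 :=
  Matrix.det_eq_zero_of_row_eq_zero y fun x => if_neg fun h => hy ⟨x, h⟩

end Determinant

/-! ### Elements with small image -/

section SmallImage

variable {Ω : Type*}

theorem mem_smallImage_iff [Fintype Ω] {M : Type*} {im : M → Set Ω} {s : M} :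
    s ∈ smallImage im ↔ ∃ y, y ∉ im s := by
  rw [← Set.ne_univ_iff_exists_notMem, smallImage, Set.mem_ofPred_eq, ← Nat.card_eq_fintype_card]
  refine ⟨fun h h' => ?_, Set.ncard_lt_card⟩
  rw [h', Set.ncard_univ] at h
  exact lt_irrefl _ h

/-- A surjective partial transformation of a finite set is a permutation. -/
theorem PartialTransf.exists_ofPerm_eq [Finite Ω] {s : PartialTransf Ω} (h : ∀ y, y ∈ s.image) :
    ∃ σ, PartialTransf.ofPerm σ = s := by
  choose g hg using h
  -- the right inverse `g` is injective, hence bijective, and `s` is its inverse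
  have hinj : Function.Injective g := fun a b hab => Part.mem_unique (hg a) (hab ▸ hg b)
  have hbij : Function.Bijective g := Finite.injective_iff_bijective.1 hinj
  refine ⟨(Equiv.ofBijective g hbij).symm, PartialTransf.ext_mem fun x y => ?_⟩
  obtain ⟨z, rfl⟩ := hbij.2 x
  have hz : (Equiv.ofBijective g hbij).symm (g z) = z := Equiv.ofBijective_symm_apply_apply g hbij z
  rw [PartialTransf.ofPerm, hz, Part.mem_some_iff]
  exact ⟨fun h => h ▸ hg z, fun h => Part.mem_unique h (hg z)⟩

theorem FullTransf.toPartial_injective : Function.Injective (FullTransf.toPartial (Ω := Ω)) :=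
  fun _ _ h => funext fun x => Part.some_injective (congrFun h x)

theorem SymmInv.toPartial_injective : Function.Injective (SymmInv.toPartial (Ω := Ω)) :=
  fun s t h => SymmInv.ext_mem fun x y => by
    rw [← SymmInv.mem_toPartial, h, SymmInv.mem_toPartial]

theorem FullTransf.image_toPartial (s : FullTransf Ω) :
    (FullTransf.toPartial s).image = s.image :=
  Set.ext fun _ => exists_congr fun _ => Part.mem_some_iff.trans eq_comm

theorem SymmInv.image_toPartial (s : SymmInv Ω) : (SymmInv.toPartial s).image = s.image :=
  Set.ext fun _ => exists_congr fun _ => SymmInv.mem_toPartial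

variable [DecidableEq Ω]

/-- The partial identity with domain the complement of a finite set. -/
def SymmInv.delete (A : Finset Ω) : SymmInv Ω := PEquiv.ofSet {x | x ∉ A}

theorem SymmInv.mem_delete {A : Finset Ω} {x y : Ω} :
    y ∈ SymmInv.delete A x ↔ y = x ∧ x ∉ A := by
  rw [SymmInv.delete, PEquiv.mem_ofSet_iff]
  constructor
  · rintro ⟨rfl, h⟩
    exact ⟨rfl, h⟩
  · rintro ⟨rfl, h⟩
    exact ⟨rfl, h⟩

theorem SymmInv.map_delete_singleton {Q : Type*} [CommMonoid Q] (f : SymmInv Ω →* Q) (x y : Ω) :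
    f (SymmInv.delete {x}) = f (SymmInv.delete {y}) := by
  have h : SymmInv.ofPerm (Equiv.swap x y) * SymmInv.ofPerm (Equiv.swap x y) = 1 := by
    rw [← map_one SymmInv.permHom, ← Equiv.swap_mul_self x y]
    exact (map_mul SymmInv.permHom _ _).symm
  rw [← map_eq_of_conj f h]
  congr 1
  refine SymmInv.ext_mem fun a b => ?_
  simp only [SymmInv.mem_mul, SymmInv.mem_ofPerm, SymmInv.mem_delete, Finset.mem_singleton]
  constructor
  · rintro ⟨_, rfl, _, ⟨rfl, h⟩, rfl⟩
    refine ⟨by simp, fun ha => h (by simp [ha])⟩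
  · rintro ⟨rfl, h⟩
    refine ⟨_, rfl, _, ⟨rfl, fun ha => h ?_⟩, by simp⟩
    exact (Equiv.swap_apply_eq_iff.1 ha).trans (by simp)

theorem SymmInv.delete_mul_delete (A B : Finset Ω) :
    SymmInv.delete A * SymmInv.delete B = SymmInv.delete (A ∪ B) := by
  refine SymmInv.ext_mem fun x y => ?_
  simp only [SymmInv.mem_mul, SymmInv.mem_delete, Finset.mem_union]
  grind

/-- The empty map is a product of one-point deletions, which have a common idempotent value. -/
theorem SymmInv.map_delete_eq_map_bot [Fintype Ω] {Q : Type*} [CommMonoid Q]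
    (f : SymmInv Ω →* Q) (y : Ω) : f (SymmInv.delete {y}) = f ⊥ := by
  have key : ∀ A : Finset Ω,
      f (SymmInv.delete {y}) * f (SymmInv.delete A) = f (SymmInv.delete {y}) := by
    intro A
    induction A using Finset.induction_on with
    | empty => rw [← map_mul, SymmInv.delete_mul_delete, Finset.union_empty]
    | insert x A _ ih =>
      rw [Finset.insert_eq, ← SymmInv.delete_mul_delete, map_mul, SymmInv.map_delete_singleton f x y,
        ih, ← map_mul, SymmInv.delete_mul_delete, Finset.union_self]
  have hbot : SymmInv.delete (Finset.univ : Finset Ω) = ⊥ :=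
    SymmInv.ext_mem fun a b => by
      rw [SymmInv.mem_delete]
      simp
  rw [← key Finset.univ, hbot, mul_comm, ← map_mul, SymmInv.bot_mul]

theorem SymmInv.delete_mul {s : SymmInv Ω} {y : Ω} (hy : y ∉ s.image) :
    SymmInv.delete {y} * s = s := by
  refine SymmInv.ext_mem fun a b => ?_
  simp only [SymmInv.mem_mul, SymmInv.mem_delete, Finset.mem_singleton]
  constructor
  · rintro ⟨z, hz, rfl, -⟩
    exact hz
  · exact fun hb => ⟨b, hb, rfl, fun h => hy ⟨a, h ▸ hb⟩⟩

theorem PartialTransf.delete_mul {s : PartialTransf Ω} {y : Ω} (hy : y ∉ s.image) :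
    SymmInv.toPartial (SymmInv.delete {y}) * s = s := by
  refine PartialTransf.ext_mem fun a b => ?_
  simp only [PartialTransf.mem_mul, SymmInv.mem_toPartial, SymmInv.mem_delete,
    Finset.mem_singleton]
  constructor
  · rintro ⟨z, hz, rfl, -⟩
    exact hz
  · exact fun hb => ⟨b, hb, rfl, fun h => hy ⟨a, h ▸ hb⟩⟩

/-- The map that sends the points of `A` to `b` and fixes all others. -/
def FullTransf.collapse (b : Ω) (A : Finset Ω) : FullTransf Ω := fun x => if x ∈ A then b else x

theorem FullTransf.map_collapse_singleton {Q : Type*} [CommMonoid Q] (f : FullTransf Ω →* Q)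
    {b x y : Ω} (hx : x ≠ b) (hy : y ≠ b) :
    f (FullTransf.collapse b {x}) = f (FullTransf.collapse b {y}) := by
  have h : FullTransf.ofPerm (Equiv.swap x y) * FullTransf.ofPerm (Equiv.swap x y) = 1 := by
    rw [← map_one FullTransf.permHom, ← Equiv.swap_mul_self x y]
    exact (map_mul FullTransf.permHom _ _).symm
  rw [← map_eq_of_conj f h]
  congr 1
  funext a
  simp only [FullTransf.mul_apply, FullTransf.ofPerm, FullTransf.collapse,
    Finset.mem_singleton]
  by_cases ha : a = y
  · simp [ha, Equiv.swap_apply_of_ne_of_ne hx.symm hy.symm]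
  · have : Equiv.swap x y a ≠ x := fun h => ha (
      (Equiv.swap_apply_eq_iff.1 h).trans (by simp))
    simp [ha, this]

theorem FullTransf.collapse_singleton_mul (b x : Ω) (A : Finset Ω) :
    FullTransf.collapse b {x} * FullTransf.collapse b A = FullTransf.collapse b (insert x A) := by
  funext a
  simp only [FullTransf.mul_apply, FullTransf.collapse, Finset.mem_singleton,
    Finset.mem_insert]
  grind

variable [Fintype Ω]

theorem SymmInv.permConj_bot {s : SymmInv Ω} (hs : s ∈ smallImage SymmInv.image) :
    PermConj s ⊥ := by
  obtain ⟨y, hy⟩ := mem_smallImage_iff.1 hs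
  rw [permConj_iff_forall_hom]
  intro Q _ f
  rw [← SymmInv.delete_mul hy, map_mul, SymmInv.map_delete_eq_map_bot, ← map_mul, SymmInv.bot_mul]

theorem PartialTransf.permConj_bot {s : PartialTransf Ω}
    (hs : s ∈ smallImage PartialTransf.image) : PermConj s (SymmInv.toPartial ⊥) := by
  obtain ⟨y, hy⟩ := mem_smallImage_iff.1 hs
  rw [permConj_iff_forall_hom]
  intro Q _ f
  have h : f (SymmInv.toPartial (SymmInv.delete {y})) = f (SymmInv.toPartial ⊥) :=
    SymmInv.map_delete_eq_map_bot (f.comp SymmInv.toPartial) y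
  rw [← PartialTransf.delete_mul hy, map_mul, h, ← map_mul, PartialTransf.toPartial_bot_mul]

/-- A constant map is a product of one-point collapses, which have a common idempotent value. -/
theorem FullTransf.map_collapse_eq_map_const {Q : Type*} [CommMonoid Q] (f : FullTransf Ω →* Q)
    {b y : Ω} (hy : y ≠ b) :
    f (FullTransf.collapse b {y}) = f (FullTransf.const b) := by
  have key : ∀ A : Finset Ω, f (FullTransf.collapse b {y}) * f (FullTransf.collapse b A) =
      f (FullTransf.collapse b {y}) := by
    intro A
    induction A using Finset.induction_on with
    | empty => rw [← map_mul, FullTransf.collapse_singleton_mul]; rfl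
    | insert x A _ ih =>
      rw [← FullTransf.collapse_singleton_mul, map_mul]
      by_cases hx : x = b
      · have h1 : FullTransf.collapse b {x} = 1 := by
          funext a
          simp +contextual [FullTransf.collapse, hx, FullTransf.one_apply]
        rw [h1, map_one, one_mul, ih]
      · rw [FullTransf.map_collapse_singleton f hx hy, ih, ← map_mul,
          FullTransf.collapse_singleton_mul, Finset.insert_eq_self.2 (Finset.mem_singleton_self y)]
  have hconst : FullTransf.collapse b Finset.univ = FullTransf.const b := by
    funext a
    simp [FullTransf.collapse, FullTransf.const]
  rw [← key Finset.univ, hconst, mul_comm, ← map_mul, FullTransf.const_mul]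

theorem FullTransf.permConj_const {s : FullTransf Ω} (hs : s ∈ smallImage FullTransf.image)
    (c : Ω) : PermConj s (FullTransf.const c) := by
  obtain ⟨y, hy⟩ := mem_smallImage_iff.1 hs
  rw [permConj_iff_forall_hom]
  intro Q _ f
  have hne : y ≠ s y := fun h => hy ⟨y, h.symm⟩
  have hmul : FullTransf.collapse (s y) {y} * s = s := by
    funext a
    have : s a ≠ y := fun h => hy ⟨a, h⟩
    simp [FullTransf.mul_apply, FullTransf.collapse, this]
  have habs : ∀ (b : Ω) (t : FullTransf Ω),
      f (FullTransf.const b) * f t = f (FullTransf.const b) := fun b t => by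
    rw [← map_mul, FullTransf.const_mul]
  rw [← hmul, map_mul, FullTransf.map_collapse_eq_map_const f hne, habs,
    ← habs (s y) (FullTransf.const c), mul_comm, habs]

end SmallImage

/-! ### The classes over a finite set -/

section Classes

variable {Ω M : Type*} [Fintype Ω] [DecidableEq Ω] [Monoid M]

/-- A homomorphism to `ℤ` that separates even permutations, odd permutations and elements with
small image shows that these are unions of classes. -/
theorem permConjSetoid_classes_eq (ι : Equiv.Perm Ω →* M) (im : M → Set Ω) (δ : M →* ℤ)
    (hδ : ∀ σ, δ (ι σ) = Equiv.Perm.sign σ) (hδ' : ∀ s ∈ smallImage im, δ s = 0)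
    (hperm : ∀ s, s ∉ smallImage im → ∃ σ, ι σ = s)
    (hsmall : ∀ s ∈ smallImage im, ∀ t ∈ smallImage im, PermConj s t) :
    (permConjSetoid M).classes = {evenPerms ι, oddPerms ι, smallImage im} \ {∅} ∧
      (2 ≤ Fintype.card Ω → (smallImage im).Nonempty →
        (permConjSetoid M).classes = {evenPerms ι, oddPerms ι, smallImage im} ∧
        (permConjSetoid M).classes.ncard = 3) := by
  have heven : ∀ s, s ∈ evenPerms ι ↔ δ s = 1 := by
    intro s
    constructor
    · rintro ⟨σ, hσ, rfl⟩
      simp [hδ, hσ]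
    · intro h
      obtain ⟨σ, rfl⟩ := hperm s fun hs => by simp [hδ' s hs] at h
      exact ⟨σ, by simpa [hδ] using h, rfl⟩
  have hodd : ∀ s, s ∈ oddPerms ι ↔ δ s = -1 := by
    intro s
    constructor
    · rintro ⟨σ, hσ, rfl⟩
      simp [hδ, hσ]
    · intro h
      obtain ⟨σ, rfl⟩ := hperm s fun hs => by simp [hδ' s hs] at h
      refine ⟨σ, ?_, rfl⟩
      rw [hδ] at h
      exact Units.ext h
  have hzero : ∀ s, s ∈ smallImage im ↔ δ s = 0 := by
    refine fun s => ⟨hδ' s, fun h => ?_⟩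
    by_contra hs
    obtain ⟨σ, rfl⟩ := hperm s hs
    rw [hδ] at h
    exact (Equiv.Perm.sign σ).ne_zero h
  have hδ_iff : ∀ s t, PermConj s t ↔ δ s = δ t := by
    refine fun s t => ⟨fun h => h.map_eq δ, fun h => ?_⟩
    by_cases hs : s ∈ smallImage im
    · exact hsmall s hs t ((hzero t).2 (h ▸ (hzero s).1 hs))
    · have ht : t ∉ smallImage im := fun ht => hs ((hzero s).2 (h ▸ (hzero t).1 ht))
      obtain ⟨σ, rfl⟩ := hperm s hs
      obtain ⟨τ, rfl⟩ := hperm t ht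
      rw [hδ, hδ] at h
      rw [permConj_iff_forall_hom]
      intro Q _ f
      exact map_perm_eq_of_sign_eq (f.comp ι) (Units.ext h)
  have hcases : ∀ s, δ s = 1 ∨ δ s = -1 ∨ δ s = 0 := by
    intro s
    by_cases hs : s ∈ smallImage im
    · exact Or.inr (Or.inr ((hzero s).1 hs))
    · obtain ⟨σ, rfl⟩ := hperm s hs
      rcases Int.units_eq_one_or (Equiv.Perm.sign σ) with h | h <;> simp [hδ, h]
  have hclass : (permConjSetoid M).classes =
      {evenPerms ι, oddPerms ι, smallImage im} \ {∅} := by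
    -- a class is a nonempty fibre of `δ`
    have hfib : ∀ (C : Set M) (n : ℤ), (∀ s, s ∈ C ↔ δ s = n) → ∀ s, δ s = n →
        {x | (permConjSetoid M) x s} = C := fun C n hC s hs => Set.ext fun x =>
      (hδ_iff x s).trans (by rw [hs, hC])
    ext C
    constructor
    · rintro ⟨s, rfl⟩
      refine ⟨?_, Set.Nonempty.ne_empty ⟨s, (permConjSetoid M).refl s⟩⟩
      rcases hcases s with h | h | h
      · exact Or.inl (hfib _ _ heven s h)
      · exact Or.inr (Or.inl (hfib _ _ hodd s h))
      · exact Or.inr (Or.inr (hfib _ _ hzero s h))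
    · rintro ⟨hC, hne⟩
      obtain ⟨s, hs⟩ := Set.nonempty_iff_ne_empty.2 hne
      rcases hC with rfl | rfl | rfl
      · exact ⟨s, (hfib _ _ heven s ((heven s).1 hs)).symm⟩
      · exact ⟨s, (hfib _ _ hodd s ((hodd s).1 hs)).symm⟩
      · exact ⟨s, (hfib _ _ hzero s ((hzero s).1 hs)).symm⟩
  refine ⟨hclass, fun hcard ⟨z, hz⟩ => ?_⟩
  obtain ⟨a, b, hab⟩ := Fintype.one_lt_card_iff.1 hcard
  have h1 : (1 : M) ∈ evenPerms ι := (heven 1).2 (map_one δ)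
  have h2 : ι (Equiv.swap a b) ∈ oddPerms ι := ⟨_, Equiv.Perm.sign_swap hab, rfl⟩
  have heq : (permConjSetoid M).classes = {evenPerms ι, oddPerms ι, smallImage im} := by
    rw [hclass, sdiff_eq_left, Set.disjoint_singleton_right]
    rintro (h | h | h)
    · exact (h ▸ h1 : (1 : M) ∈ (∅ : Set M))
    · exact (h ▸ h2 : ι (Equiv.swap a b) ∈ (∅ : Set M))
    · exact (h ▸ hz : z ∈ (∅ : Set M))
  refine ⟨heq, ?_⟩
  rw [heq, Set.ncard_eq_three]
  refine ⟨_, _, _, fun h => ?_, fun h => ?_, fun h => ?_, rfl⟩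
  · have := (hodd 1).1 (h ▸ h1)
    rw [map_one] at this
    omega
  · have := (hzero 1).1 (h ▸ h1)
    rw [map_one] at this
    omega
  · have e1 := (hodd _).1 h2
    have e2 := (hzero _).1 (h ▸ h2)
    omega

end Classes

theorem mainTheorem6 (Ω : Type*) :
    (Infinite Ω →
      (∀ s t : FullTransf Ω, PermConj s t) ∧
      (∀ s t : PartialTransf Ω, PermConj s t) ∧
      (∀ s t : SymmInv Ω, PermConj s t)) ∧
    (∀ [Fintype Ω] [DecidableEq Ω],
      ((permConjSetoid (FullTransf Ω)).classes =
          {evenPerms FullTransf.ofPerm, oddPerms FullTransf.ofPerm,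
            smallImage FullTransf.image} \ {∅} ∧
        (permConjSetoid (PartialTransf Ω)).classes =
          {evenPerms PartialTransf.ofPerm, oddPerms PartialTransf.ofPerm,
            smallImage PartialTransf.image} \ {∅} ∧
        (permConjSetoid (SymmInv Ω)).classes =
          {evenPerms SymmInv.ofPerm, oddPerms SymmInv.ofPerm,
            smallImage SymmInv.image} \ {∅}) ∧
      (2 ≤ Fintype.card Ω →
        ((permConjSetoid (FullTransf Ω)).classes =
            {evenPerms FullTransf.ofPerm, oddPerms FullTransf.ofPerm,
              smallImage FullTransf.image} ∧
          (permConjSetoid (FullTransf Ω)).classes.ncard = 3) ∧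
        ((permConjSetoid (PartialTransf Ω)).classes =
            {evenPerms PartialTransf.ofPerm, oddPerms PartialTransf.ofPerm,
              smallImage PartialTransf.image} ∧
          (permConjSetoid (PartialTransf Ω)).classes.ncard = 3) ∧
        ((permConjSetoid (SymmInv Ω)).classes =
            {evenPerms SymmInv.ofPerm, oddPerms SymmInv.ofPerm,
              smallImage SymmInv.image} ∧
          (permConjSetoid (SymmInv Ω)).classes.ncard = 3))) := by
  refine ⟨fun _ => ⟨FullTransf.permConj_of_infinite, PartialTransf.permConj_of_infinite,
    SymmInv.permConj_of_infinite⟩, ?_⟩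
  intro _ _
  have hF := permConjSetoid_classes_eq FullTransf.permHom FullTransf.image
    (PartialTransf.det.comp (FullTransf.toPartial (Ω := Ω))) PartialTransf.det_ofPerm
    (fun s hs => by
      obtain ⟨y, hy⟩ := mem_smallImage_iff.1 hs
      exact PartialTransf.det_eq_zero (y := y) (by rwa [FullTransf.image_toPartial]))
    (fun s hs => by
      rw [mem_smallImage_iff] at hs
      push Not at hs
      obtain ⟨σ, hσ⟩ := PartialTransf.exists_ofPerm_eq (s := FullTransf.toPartial s)
        (by rwa [FullTransf.image_toPartial])
      exact ⟨σ, FullTransf.toPartial_injective hσ⟩)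
    (fun s hs t ht => by
      obtain ⟨c, -⟩ := mem_smallImage_iff.1 hs
      exact (FullTransf.permConj_const hs c).trans (FullTransf.permConj_const ht c).symm)
  have hP := permConjSetoid_classes_eq PartialTransf.permHom PartialTransf.image
    (PartialTransf.det (Ω := Ω)) PartialTransf.det_ofPerm
    (fun s hs => by
      obtain ⟨y, hy⟩ := mem_smallImage_iff.1 hs
      exact PartialTransf.det_eq_zero hy)
    (fun s hs => by
      rw [mem_smallImage_iff] at hs
      push Not at hs
      exact PartialTransf.exists_ofPerm_eq hs)
    (fun s hs t ht => (PartialTransf.permConj_bot hs).trans (PartialTransf.permConj_bot ht).symm)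
  have hS := permConjSetoid_classes_eq SymmInv.permHom SymmInv.image
    (PartialTransf.det.comp (SymmInv.toPartial (Ω := Ω)))
    (fun σ => (congrArg PartialTransf.det (SymmInv.toPartial_ofPerm σ)).trans
      (PartialTransf.det_ofPerm σ))
    (fun s hs => by
      obtain ⟨y, hy⟩ := mem_smallImage_iff.1 hs
      exact PartialTransf.det_eq_zero (y := y) (by rwa [SymmInv.image_toPartial]))
    (fun s hs => by
      rw [mem_smallImage_iff] at hs
      push Not at hs
      obtain ⟨σ, hσ⟩ := PartialTransf.exists_ofPerm_eq (s := SymmInv.toPartial s)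
        (by rwa [SymmInv.image_toPartial])
      exact ⟨σ, SymmInv.toPartial_injective ((SymmInv.toPartial_ofPerm σ).trans hσ)⟩)
    (fun s hs t ht => (SymmInv.permConj_bot hs).trans (SymmInv.permConj_bot ht).symm)
  refine ⟨⟨hF.1, hP.1, hS.1⟩, fun hcard => ?_⟩
  obtain ⟨a, b, hab⟩ := Fintype.one_lt_card_iff.1 hcard
  refine ⟨hF.2 hcard ⟨FullTransf.const a, ?_⟩, hP.2 hcard ⟨SymmInv.toPartial ⊥, ?_⟩, hS.2 hcard ⟨⊥, ?_⟩⟩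
  · exact mem_smallImage_iff.2 ⟨b, fun ⟨_, h⟩ => hab h⟩
  · refine mem_smallImage_iff.2 ⟨a, ?_⟩
    simp [SymmInv.image_toPartial, SymmInv.image]
  · exact mem_smallImage_iff.2 ⟨a, by simp [SymmInv.image]⟩
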